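/- Let $H_2(p)=-p\log p-(1-p)\log(1-p)$ be the binary entropy function (natural logarithms throughout) and, for a harvest rate $q\in(0,1]$, let $$C_{UB}^{genie}(q)=\max_{p\in[0,1]}\frac{q\,H_2(p)}{q+p(1-q)}$$ be the genie upper bound of the binary energy harvesting channel with unit battery. Timing channel. The idle times $Z_1,Z_2,\dots$ are i.i.d. geometric, $\Pr[Z=z]=q(1-q)^z$ for $z\in\{0,1,\dots\}$. In channel use $k$ the encoder, knowing the message $W$ and $Z_1,\dots,Z_k$, chooses an input $V_k\in\{1,2,\dots\}$, and the decoder observes $T_k=V_k+Z_k$. For a code with $M$ equally likely messages and $m$ channel uses the rate, per use of the binary channel, is $\log M/\sum_{k=1}^m\mathbb E[T_k]$, the expectation being over the message and the idle times. A number $R$ is achievable if for every $\varepsilon>0$ and all large $m$ there is such a code with finite expected duration, average error probability at most $\varepsilon$ and rate at least $R-\varepsilon$. The capacity $C_T(q)$ is the supremum of the achievable $R$. Modulo encoding. For $N\ge 1$ a symbol $U\in\{0,\dots,N-1\}$ independent of $Z$ is sent by the input $V=v(U,Z)=((U-Z)\bmod N)+1$. With $U$ of law $P$ its rate is $H(U)/\mathbb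 E[V+Z]$. Let $R_A^{mod}(q)$ be the supremum of this rate over all $N$ and all laws $P$ on $\{0,\dots,N-1\}$. **Theorem.** For every $q\in(0,1]$ the maximum defining $C_{UB}^{genie}(q)$ is attained. For each $q$ let $p^*=p^*(q)$ be a maximizer, put $N=\lceil 1/p^*\rceil$, and let $R_A^{unif}(q)=\dfrac{H(U)}{\mathbb E[V+Z]}$ be the rate of modulo encoding with $U$ uniform on $\{0,\dots,N-1\}$. Then $R_A^{unif}(q)$ is achievable on the timing channel, with codes that use modulo encoding with this $N$, and modulo encoding is asymptotically optimal as $q\to0$: $$\lim_{q\to0}\frac{C_{UB}^{genie}(q)}{R_A^{unif}(q)}=\lim_{q\to0}\frac{C_{UB}^{genie}(q)}{R_A^{mod}(q)}=\lim_{q\to0}\frac{C_T(q)}{R_A^{unif}(q)}=\lim_{q\to0}\frac{C_T(q)}{R_A^{mod}(q)}=1 .$$ -/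

import Mathlib

open Filter Topology MeasureTheory ProbabilityTheory

noncomputable section

namespace BEHC

/-! ### The genie upper bound (all information quantities are in nats) -/

/-- The objective `q H₂(p) / (q + p (1 - q))` of the genie upper bound. -/
def genieObjective (q : unitInterval) (p : ℝ) : ℝ :=
  (q : ℝ) * Real.binEntropy p / ((q : ℝ) + p * (1 - (q : ℝ)))

/-- The genie upper bound `max_{p ∈ [0,1]} q H₂(p) / (q + p (1 - q))`. -/
def genieBound (q : unitInterval) : ℝ :=
  sSup (genieObjective q '' Set.Icc 0 1)

/-! ### The timing channel `T = V + Z`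

The idle times `Z₁, …, Zₘ` are i.i.d. geometric with parameter `q` on `{0, 1, …}`, that is, their
law is `Measure.pi fun _ => geometricMeasure q`. -/

/-- A code with `M` messages for `m` uses of the timing channel. `enc w k z` is the input `V_k` sent
in use `k` when the message is `w` and the idle times are `z`. -/
structure TimingCode (M m : ℕ) where
  /-- the encoder -/
  enc : Fin M → Fin m → (Fin m → ℕ) → ℕ
  /-- the decoder, which sees the outputs `T₁, …, Tₘ` only -/
  dec : (Fin m → ℕ) → Fin M
  /-- inputs lie in `{1, 2, …}` -/
  one_le_enc : ∀ w k z, 1 ≤ enc w k z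
  /-- the idle times are known causally: `V_k` depends on `z` through `z_j`, `j ≤ k` -/
  causal : ∀ w k z z', (∀ j ≤ k, z j = z' j) → enc w k z = enc w k z'

namespace TimingCode

variable {M m : ℕ}

/-- The channel output `T_k = V_k + Z_k`. -/
def output (c : TimingCode M m) (w : Fin M) (z : Fin m → ℕ) (k : Fin m) : ℕ :=
  c.enc w k z + z k

/-- The probability of decoding error, for a uniformly distributed message. -/
def errorProb (q : unitInterval) (c : TimingCode M m) : ℝ :=
  (M : ℝ)⁻¹ * ∑ w, (Measure.pi fun _ : Fin m => geometricMeasure q).real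
    {z | c.dec (c.output w z) ≠ w}

/-- The expected total duration `∑ k, E[T_k]` of a codeword, in uses of the binary channel, for a
uniformly distributed message. -/
def duration (q : unitInterval) (c : TimingCode M m) : ENNReal :=
  (M : ENNReal)⁻¹ * ∑ w, ∫⁻ z, ((∑ k, c.output w z k : ℕ) : ENNReal)
    ∂(Measure.pi fun _ : Fin m => geometricMeasure q)

/-- The rate `log M / ∑ k, E[T_k]` per use of the binary channel. -/
def rate (q : unitInterval) (c : TimingCode M m) : ℝ :=
  Real.log M / (c.duration q).toReal

end TimingCode

/-- `R` is achievable with codes from the class `𝒞`: for each `ε > 0` and all large block lengths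
there is a code in `𝒞` with error probability at most `ε`, finite expected duration and rate at
least `R - ε`. -/
def IsAchievable (q : unitInterval) (𝒞 : ∀ M m : ℕ, Set (TimingCode M m)) (R : ℝ) : Prop :=
  ∀ ε : ℝ, 0 < ε → ∃ m₀ : ℕ, ∀ m ≥ m₀, ∃ (M : ℕ) (c : TimingCode M m), c ∈ 𝒞 M m ∧
    c.errorProb q ≤ ε ∧ c.duration q ≠ ⊤ ∧ R - ε ≤ c.rate q

/-- The capacity of the timing channel, per use of the binary channel. -/
def capacity (q : unitInterval) : ℝ :=
  sSup {R | IsAchievable q (fun _ _ => Set.univ) R}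

/-! ### Modulo encoding -/

/-- The map `v(u, z) = ((u - z) mod N) + 1`, with the residue taken in `{0, …, N - 1}`. -/
def moduloInput (N : ℕ) (u : Fin N) (z : ℕ) : ℕ :=
  ((((u : ℕ) : ℤ) - (z : ℤ)) % (N : ℤ)).toNat + 1

/-- Codes that use modulo encoding: each message `w` has a codeword `a w` over `{0, …, N - 1}`, and
the input in use `k` is `v(a w k, Z_k)`. -/
def moduloCodes (N M m : ℕ) : Set (TimingCode M m) :=
  {c | ∃ a : Fin M → Fin m → Fin N, ∀ w k z, c.enc w k z = moduloInput N (a w k) (z k)}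

/-- `E[V + Z]` for `V = v(U, Z)`, with `U` of probability mass function `P` independent of `Z`. -/
def moduloDuration (q : unitInterval) (N : ℕ) (P : Fin N → ℝ) : ℝ :=
  ∑ u, P u * ∫ z, ((moduloInput N u z : ℝ) + (z : ℝ)) ∂(geometricMeasure q)

/-- The rate `H(U) / E[V + Z]` of modulo encoding for `U` with probability mass function `P`. -/
def moduloRate (q : unitInterval) (N : ℕ) (P : Fin N → ℝ) : ℝ :=
  (∑ u, Real.negMulLog (P u)) / moduloDuration q N P

/-- The rate of modulo encoding for `U` uniform on `{0, …, N - 1}`. -/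
def uniformModuloRate (q : unitInterval) (N : ℕ) : ℝ :=
  moduloRate q N fun _ => (N : ℝ)⁻¹

/-- The best rate of modulo encoding, over all `N` and all laws of `U` on `{0, …, N - 1}`. -/
def bestModuloRate (q : unitInterval) : ℝ :=
  sSup {R | ∃ (N : ℕ) (P : Fin N → ℝ), P ∈ stdSimplex ℝ (Fin N) ∧ R = moduloRate q N P}

end BEHC

end

/-!
The genie objective is `q H₂(x)` over `q + x (1 - q)`. By Gibbs' inequality, `H₂(x)` is at most the
cross entropy of `(x, 1 - x)` and `(p, 1 - p)`, and if `p` is *balanced*, `q log p = log (1 - p)`,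
this cross entropy is a constant multiple of the denominator. A balanced `p` exists by the
intermediate value theorem; it is therefore the only maximizer, and the genie bound is
`C = -log (1 - p)`, the solution of `exp (-C) + exp (-C / q) = 1`.

The same identity says that the geometric weight `p (1 - p) ^ (v - 1)` of an input `v` equals
`exp (-C (v + E[Z]))` (`Balanced.log_inputWeight`). As the weights sum to `1`, fixing the idle times
and applying Kraft's inequality to the correctly decoded messages shows that a code with `M`
messages satisfies `log M ≤ C D / (1 - ε) - log (1 - ε)` for its duration `D` and error
probability `ε`
(`TimingCode.log_size_le`). So the capacity is at most `C`, and Gibbs' inequality with these weights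
gives the same for every rate of modulo encoding.

Conversely, modulo encoding can be inverted at the receiver, because `T - 1` is congruent to `U`
modulo `N`. All `N ^ m` words can thus be used without error, and the uniform rate is achieved
exactly. With `N = ⌈1 / p⌉` it equals `log N / ((N + 1) / 2 + (1 - q) / q)`, where
`log N ≥ -log p = C / q`; the genie bound exceeds it by a factor of at most `1 + q / (2 p)`, and
`q / p = O(1 / log (1 / q))` (`Balanced.div_le`). All the other ratios are squeezed by this one.
-/

namespace BEHC

/-! ### The genie bound and its maximizer -/

lemma negMulLog_lt_of_ne {x a : ℝ} (hx : 0 ≤ x) (ha : 0 < a) (hxa : x ≠ a) :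
    Real.negMulLog x < a - x - x * Real.log a := by
  have h := Real.self_sub_one_lt_mul_log (x := x / a) (by positivity)
    (by rwa [ne_eq, div_eq_one_iff_eq ha.ne'])
  rcases hx.eq_or_lt with rfl | hx
  · simpa using ha
  · rw [Real.log_div hx.ne' ha.ne'] at h
    have h' := mul_lt_mul_of_pos_left h ha
    have e : a * (x / a) = x := by field_simp
    rw [Real.negMulLog]
    nlinarith [congrArg (· * (Real.log x - Real.log a)) e]

/-- One term of Gibbs' inequality: over two laws summing to `1`, the terms `a - x` cancel. -/
lemma negMulLog_le {x a : ℝ} (hx : 0 ≤ x) (ha : 0 < a) :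
    Real.negMulLog x ≤ a - x - x * Real.log a := by
  rcases eq_or_ne x a with rfl | h
  · simp [Real.negMulLog]
  · exact (negMulLog_lt_of_ne hx ha h).le

/-- `p` is balanced for `q` if `p = (1 - p) ^ (1 / q)`, written with logarithms. Then
`λ = -log (1 - p)` satisfies `exp (-λ) + exp (-λ / q) = 1`. -/
structure Balanced (q : unitInterval) (p : ℝ) : Prop where
  pos : 0 < p
  lt_one : p < 1
  log_eq : (q : ℝ) * Real.log p = Real.log (1 - p)

lemma coe_pos {q : unitInterval} (hq : q ≠ 0) : 0 < (q : ℝ) :=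
  lt_of_le_of_ne q.2.1 fun h => hq (Subtype.ext h.symm)

lemma exists_balanced {q : unitInterval} (hq : q ≠ 0) : ∃ p, Balanced q p := by
  have hq0 := coe_pos hq
  have hc : ContinuousOn (fun p : ℝ => p - (1 - p) ^ (1 / (q : ℝ))) (Set.Icc 0 1) := by
    refine continuousOn_id.sub (ContinuousOn.rpow_const (by fun_prop) fun x _ => Or.inr ?_)
    positivity
  have hmem : (0 : ℝ) ∈ Set.Icc ((0 : ℝ) - (1 - 0) ^ (1 / (q : ℝ)))
      ((1 : ℝ) - (1 - 1) ^ (1 / (q : ℝ))) := by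
    simp [Real.zero_rpow, hq0.ne']
  obtain ⟨p, ⟨hp0, hp1⟩, hp⟩ := intermediate_value_Icc zero_le_one hc hmem
  have hp' : p = (1 - p) ^ (1 / (q : ℝ)) := by simpa [sub_eq_zero] using hp
  have h1 : p ≠ 1 := by
    rintro rfl
    rw [sub_self, Real.zero_rpow (by positivity)] at hp'
    exact one_ne_zero hp'
  have h0 : p ≠ 0 := by
    rintro rfl
    simp at hp'
  have hlt : p < 1 := lt_of_le_of_ne hp1 h1
  refine ⟨p, lt_of_le_of_ne hp0 h0.symm, hlt, ?_⟩
  conv_lhs => rw [hp', Real.log_rpow (by linarith)]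
  field_simp

namespace Balanced

variable {q : unitInterval} {p : ℝ}

lemma log_one_sub_neg (h : Balanced q p) : Real.log (1 - p) < 0 :=
  Real.log_neg (by linarith [h.lt_one]) (by linarith [h.pos])

lemma q_pos (h : Balanced q p) : 0 < (q : ℝ) := by
  have h1 := h.log_eq
  have h2 := Real.log_neg h.pos h.lt_one
  have h3 := h.log_one_sub_neg
  by_contra hq
  nlinarith

lemma q_ne_zero (h : Balanced q p) : q ≠ 0 := by
  rintro rfl
  exact lt_irrefl _ h.q_pos

lemma den_pos (h : Balanced q p) {x : ℝ} (hx : x ∈ Set.Icc (0 : ℝ) 1) :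
    0 < (q : ℝ) + x * (1 - q) := by
  have := h.q_pos
  have := mul_nonneg hx.1 (sub_nonneg.2 q.2.2)
  linarith

/-- The cross entropy of the laws `(x, 1 - x)` and `(p, 1 - p)` is proportional to the denominator
of the objective, which is what singles out the balanced `p`. -/
lemma cross_entropy (h : Balanced q p) (x : ℝ) :
    q * (x * Real.log p + (1 - x) * Real.log (1 - p)) =
      Real.log (1 - p) * (q + x * (1 - q)) := by
  linear_combination x * h.log_eq

lemma objective_self (h : Balanced q p) : genieObjective q p = -Real.log (1 - p) := by
  rw [genieObjective, div_eq_iff (h.den_pos ⟨h.pos.le, h.lt_one.le⟩).ne',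
    Real.binEntropy_eq_negMulLog_add_negMulLog_one_sub, Real.negMulLog, Real.negMulLog]
  linear_combination -h.cross_entropy p

lemma objective_lt (h : Balanced q p) {x : ℝ} (hx : x ∈ Set.Icc (0 : ℝ) 1) (hxp : x ≠ p) :
    genieObjective q x < -Real.log (1 - p) := by
  rw [genieObjective, div_lt_iff₀ (h.den_pos hx),
    Real.binEntropy_eq_negMulLog_add_negMulLog_one_sub]
  have h1 := negMulLog_lt_of_ne hx.1 h.pos hxp
  have h2 := negMulLog_le (sub_nonneg.2 hx.2) (sub_pos.2 h.lt_one)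
  have h3 := mul_lt_mul_of_pos_left (add_lt_add_of_lt_of_le h1 h2) h.q_pos
  linarith [h.cross_entropy x]

lemma objective_le (h : Balanced q p) {x : ℝ} (hx : x ∈ Set.Icc (0 : ℝ) 1) :
    genieObjective q x ≤ -Real.log (1 - p) := by
  rcases eq_or_ne x p with rfl | hne
  · exact h.objective_self.le
  · exact (h.objective_lt hx hne).le

lemma isMaxOn (h : Balanced q p) : IsMaxOn (genieObjective q) (Set.Icc 0 1) p := fun x hx => by
  simpa [h.objective_self] using h.objective_le hx

lemma eq_of_isMaxOn (h : Balanced q p) {x : ℝ} (hx : x ∈ Set.Icc (0 : ℝ) 1)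
    (hmax : IsMaxOn (genieObjective q) (Set.Icc 0 1) x) : x = p := by
  by_contra hne
  have h1 : genieObjective q p ≤ genieObjective q x := hmax ⟨h.pos.le, h.lt_one.le⟩
  exact absurd (h.objective_lt hx hne) (not_lt.2 (h.objective_self ▸ h1))

lemma genieBound_eq (h : Balanced q p) : genieBound q = -Real.log (1 - p) := by
  refine IsGreatest.csSup_eq ⟨⟨p, ⟨h.pos.le, h.lt_one.le⟩, h.objective_self⟩, ?_⟩
  rintro _ ⟨x, hx, rfl⟩
  exact h.objective_le hx

/-- If `p > 1 / 2`, then `log (1 - p) < log p ≤ q log p`. -/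
lemma le_half (h : Balanced q p) : p ≤ 1 / 2 := by
  by_contra! hp
  have h1 : Real.log (1 - p) < Real.log p :=
    Real.log_lt_log (by linarith [h.lt_one]) (by linarith)
  have h2 := Real.log_neg h.pos h.lt_one
  have h3 := h.log_eq
  nlinarith [q.2.2]

/-- From `p ≤ -log (1 - p) = -q log p` and `-p log p ≤ 1`. -/
lemma sq_le (h : Balanced q p) : p ^ 2 ≤ q := by
  have h1 : p ≤ -Real.log (1 - p) := by
    have := Real.log_le_sub_one_of_pos (sub_pos.2 h.lt_one)
    linarith
  have h2 : -Real.log p * p ≤ 1 := by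
    have h3 := Real.self_sub_one_le_mul_log h.pos.le
    linarith [h.pos]
  have h4 := mul_le_mul_of_nonneg_left h2 h.q_pos.le
  have h5 : p * p ≤ -Real.log (1 - p) * p := mul_le_mul_of_nonneg_right h1 h.pos.le
  rw [← h.log_eq] at h5
  nlinarith

/-- As `-log (1 - p) ≤ p / (1 - p) ≤ 2 p` and `p ≤ √q`, the ratio `q / p` tends to `0`. -/
lemma div_le (h : Balanced q p) (hq : (q : ℝ) < 1) : (q : ℝ) / p ≤ 4 / -Real.log q := by
  have hlq : 0 < -Real.log q := neg_pos.2 (Real.log_neg h.q_pos hq)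
  have h1 : -Real.log (1 - p) ≤ 2 * p := by
    have hpos : 0 < 1 - p := sub_pos.2 h.lt_one
    have h2 := Real.one_sub_inv_le_log_of_pos hpos
    have h3 : (1 - p)⁻¹ ≤ 1 + 2 * p := by
      rw [inv_le_iff_one_le_mul₀ hpos]
      nlinarith [h.le_half, h.pos]
    linarith
  have h2 : -Real.log q ≤ 2 * -Real.log p := by
    have := Real.log_le_log (by have := h.pos; positivity) h.sq_le
    rw [Real.log_pow] at this
    push_cast at this
    linarith
  rw [div_le_div_iff₀ h.pos hlq]
  have h3 := mul_le_mul_of_nonneg_left h2 h.q_pos.le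
  have h4 := h.log_eq
  linarith

end Balanced

/-! ### The geometric law and Kraft's inequality -/

lemma integrable_geometric {q : unitInterval} (hq : q ≠ 0) :
    Integrable (fun z : ℕ => (z : ℝ)) (geometricMeasure q) := by
  have hq0 := coe_pos hq
  rw [integrable_geometricMeasure_iff hq]
  have := (hasSum_coe_mul_geometric_of_norm_lt_one (𝕜 := ℝ) (r := 1 - q)
    (by rw [Real.norm_eq_abs, abs_lt]; constructor <;> linarith [q.2.2])).summable.mul_right (q : ℝ)
  refine this.congr fun n => ?_
  simp
  ring

lemma integral_geometric {q : unitInterval} (hq : q ≠ 0) :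
    ∫ z, (z : ℝ) ∂(geometricMeasure q) = (1 - q) / q := by
  have hq0 := coe_pos hq
  rw [integral_geometricMeasure hq]
  have := (hasSum_coe_mul_geometric_of_norm_lt_one (𝕜 := ℝ) (r := 1 - q)
    (by rw [Real.norm_eq_abs, abs_lt]; constructor <;> linarith [q.2.2])).mul_right (q : ℝ)
  have e : (fun n : ℕ => ((1 - q : ℝ) ^ n * q) • (n : ℝ)) =
      fun n : ℕ => (n : ℝ) * (1 - q : ℝ) ^ n * q := by
    ext n
    simp
    ring
  rw [e, this.tsum_eq, sub_sub_cancel]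
  field_simp

/-- The geometric probability mass function with parameter `p` on `{1, 2, …}`. -/
noncomputable def inputWeight (p : ℝ) (v : ℕ) : ℝ := p * (1 - p) ^ (v - 1)

lemma inputWeight_pos {p : ℝ} (h0 : 0 < p) (h1 : p < 1) (v : ℕ) : 0 < inputWeight p v :=
  mul_pos h0 (pow_pos (sub_pos.2 h1) _)

lemma sum_inputWeight_Icc {p : ℝ} (n : ℕ) :
    ∑ v ∈ Finset.Icc 1 n, inputWeight p v = 1 - (1 - p) ^ n := by
  induction n with
  | zero => simp
  | succ n ih =>
    rw [Finset.sum_Icc_succ_top (by omega), ih, inputWeight, Nat.add_sub_cancel]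
    ring

/-- Distinct input sequences have total weight at most `1`. -/
lemma sum_prod_inputWeight_le_one {p : ℝ} (h0 : 0 < p) (h1 : p < 1) {m : ℕ}
    (s : Finset (Fin m → ℕ)) (hs : ∀ v ∈ s, ∀ k, 1 ≤ v k) :
    ∑ v ∈ s, ∏ k, inputWeight p (v k) ≤ 1 := by
  set n := s.sup fun v => Finset.univ.sup v
  have hsub : s ⊆ Fintype.piFinset fun _ => Finset.Icc 1 n := by
    intro v hv
    simp only [Fintype.mem_piFinset, Finset.mem_Icc]
    exact fun k => ⟨hs v hv k, (Finset.le_sup (Finset.mem_univ k)).trans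
      (Finset.le_sup (f := fun v : Fin m → ℕ => Finset.univ.sup v) hv)⟩
  refine (Finset.sum_le_sum_of_subset_of_nonneg hsub fun v _ _ =>
    Finset.prod_nonneg fun k _ => (inputWeight_pos h0 h1 _).le).trans ?_
  rw [← Finset.prod_univ_sum (fun _ => Finset.Icc 1 n) fun _ v => inputWeight p v]
  have hpow : 0 ≤ (1 - p) ^ n := pow_nonneg (sub_nonneg.2 h1.le) _
  have hpow' : (1 - p) ^ n ≤ 1 := pow_le_one₀ (sub_nonneg.2 h1.le) (by linarith)
  exact Finset.prod_le_one (fun k _ => by rw [sum_inputWeight_Icc]; linarith)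
    fun k _ => by rw [sum_inputWeight_Icc]; linarith

lemma sum_inputWeight_le_one {p : ℝ} (h0 : 0 < p) (h1 : p < 1) (s : Finset ℕ)
    (hs : ∀ v ∈ s, 1 ≤ v) : ∑ v ∈ s, inputWeight p v ≤ 1 := by
  have hsub : s ⊆ Finset.Icc 1 (s.sup id) := fun v hv =>
    Finset.mem_Icc.2 ⟨hs v hv, Finset.le_sup (f := id) hv⟩
  refine (Finset.sum_le_sum_of_subset_of_nonneg hsub fun v _ _ =>
    (inputWeight_pos h0 h1 _).le).trans ?_
  rw [sum_inputWeight_Icc]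
  linarith [pow_nonneg (sub_nonneg.2 h1.le) (s.sup id)]

/-- The cost identity: for balanced `p` the negative log-weight of an input is the genie bound
times its duration, the mean idle time included. -/
lemma Balanced.log_inputWeight {q : unitInterval} {p : ℝ} (h : Balanced q p) {v : ℕ}
    (hv : 1 ≤ v) :
    Real.log (inputWeight p v) = Real.log (1 - p) * (v + (1 - q) / q) := by
  have hq := h.q_pos
  rw [inputWeight, Real.log_mul h.pos.ne' (pow_pos (sub_pos.2 h.lt_one) _).ne', Real.log_pow,
    Nat.cast_sub hv, ← h.log_eq]
  field_simp
  push_cast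
  ring

/-! ### The converse for the timing channel -/

namespace TimingCode

variable {M m : ℕ} {q : unitInterval}

/-- The law of the idle times. -/
noncomputable abbrev idleLaw (q : unitInterval) (m : ℕ) : Measure (Fin m → ℕ) :=
  Measure.pi fun _ => geometricMeasure q

/-- The real-valued duration of the transmission of `w` under idle times `z`. -/
noncomputable def time (c : TimingCode M m) (w : Fin M) (z : Fin m → ℕ) : ℝ :=
  ∑ k, (c.output w z k : ℝ)

lemma size_pos (c : TimingCode M m) : 0 < M := Fin.pos (c.dec fun _ => 0)

lemma time_nonneg (c : TimingCode M m) (w : Fin M) (z : Fin m → ℕ) : 0 ≤ c.time w z :=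
  Finset.sum_nonneg fun _ _ => Nat.cast_nonneg _

lemma lintegral_eq (c : TimingCode M m) (w : Fin M) :
    ∫⁻ z, ((∑ k, c.output w z k : ℕ) : ENNReal) ∂(idleLaw q m) =
      ∫⁻ z, ENNReal.ofReal (c.time w z) ∂(idleLaw q m) := by
  refine lintegral_congr fun z => ?_
  rw [time, ← Nat.cast_sum, ENNReal.ofReal_natCast]

lemma integrable_time (c : TimingCode M m) (hc : c.duration q ≠ ⊤) (w : Fin M) :
    Integrable (c.time w) (idleLaw q m) := by
  refine ⟨Measurable.of_discrete.aestronglyMeasurable, ?_⟩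
  rw [hasFiniteIntegral_iff_ofReal (Eventually.of_forall (c.time_nonneg w)), ← c.lintegral_eq]
  rw [duration] at hc
  have h1 : ∑ w, ∫⁻ z, ((∑ k, c.output w z k : ℕ) : ENNReal) ∂(idleLaw q m) ≠ ⊤ := by
    intro h
    rw [h] at hc
    exact hc (ENNReal.mul_top (by simp))
  exact lt_top_iff_ne_top.2 (ENNReal.sum_ne_top.1 h1 w (Finset.mem_univ w))

lemma duration_eq (c : TimingCode M m) (hc : ∀ w, Integrable (c.time w) (idleLaw q m)) :
    c.duration q = ENNReal.ofReal ((M : ℝ)⁻¹ * ∑ w, ∫ z, c.time w z ∂(idleLaw q m)) := by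
  have hM : 0 < (M : ℝ) := Nat.cast_pos.2 c.size_pos
  rw [ENNReal.ofReal_mul (by positivity), ENNReal.ofReal_inv_of_pos hM, ENNReal.ofReal_natCast,
    ENNReal.ofReal_sum_of_nonneg fun w _ => integral_nonneg (c.time_nonneg w), duration]
  congr 1
  refine Finset.sum_congr rfl fun w _ => ?_
  rw [c.lintegral_eq, ofReal_integral_eq_lintegral_ofReal (hc w)
    (Eventually.of_forall (c.time_nonneg w))]

lemma toReal_duration (c : TimingCode M m) (hc : ∀ w, Integrable (c.time w) (idleLaw q m)) :
    (c.duration q).toReal = (M : ℝ)⁻¹ * ∑ w, ∫ z, c.time w z ∂(idleLaw q m) := by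
  rw [c.duration_eq hc, ENNReal.toReal_ofReal]
  exact mul_nonneg (by positivity)
    (Finset.sum_nonneg fun w _ => integral_nonneg (c.time_nonneg w))

lemma le_toReal_duration (c : TimingCode M m) (hc : c.duration q ≠ ⊤) :
    (m : ℝ) ≤ (c.duration q).toReal := by
  have hM : 0 < (M : ℝ) := Nat.cast_pos.2 c.size_pos
  rw [c.toReal_duration (c.integrable_time hc), le_inv_mul_iff₀ hM]
  have h : ∀ w ∈ Finset.univ, (m : ℝ) ≤ ∫ z, c.time w z ∂(idleLaw q m) := fun w _ => by
    have h1 : ∀ z, (m : ℝ) ≤ c.time w z := fun z => by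
      have : ∑ _k : Fin m, (1 : ℝ) ≤ c.time w z := Finset.sum_le_sum fun k _ => by
        exact_mod_cast (c.one_le_enc w k z).trans (Nat.le_add_right _ _)
      simpa using this
    simpa using integral_mono (integrable_const (m : ℝ)) (c.integrable_time hc w) h1
  simpa using Finset.sum_le_sum h

lemma integrable_eval {f : ℕ → ℝ} (hf : Integrable f (geometricMeasure q))
    (k : Fin m) : Integrable (fun z : Fin m → ℕ => f (z k)) (idleLaw q m) :=
  (measurePreserving_eval (fun _ : Fin m => geometricMeasure q) k).integrable_comp_of_integrable hf

lemma integral_eval (f : ℕ → ℝ) (k : Fin m) :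
    ∫ z, f (z k) ∂(idleLaw q m) = ∫ n, f n ∂(geometricMeasure q) := by
  have h := measurePreserving_eval (fun _ : Fin m => geometricMeasure q) k
  rw [← h.map_eq, integral_map h.measurable.aemeasurable
    Measurable.of_discrete.aestronglyMeasurable]

/-- The duration with each idle time replaced by its mean. -/
noncomputable def meanTime (q : unitInterval) (c : TimingCode M m) (w : Fin M)
    (z : Fin m → ℕ) : ℝ :=
  ∑ k, ((c.enc w k z : ℝ) + (1 - q) / q)

lemma meanTime_nonneg (c : TimingCode M m) (w : Fin M) (z : Fin m → ℕ) :
    0 ≤ c.meanTime q w z :=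
  Finset.sum_nonneg fun _ _ =>
    add_nonneg (Nat.cast_nonneg _) (div_nonneg (sub_nonneg.2 q.2.2) q.2.1)

lemma meanTime_eq (c : TimingCode M m) (w : Fin M) (z : Fin m → ℕ) :
    c.meanTime q w z = c.time w z - ∑ k, ((z k : ℝ) - (1 - q) / q) := by
  rw [meanTime, time, ← Finset.sum_sub_distrib]
  refine Finset.sum_congr rfl fun k _ => ?_
  rw [output]
  push_cast
  ring

lemma integrable_idle_sub (hq : q ≠ 0) (k : Fin m) :
    Integrable (fun z : Fin m → ℕ => (z k : ℝ) - (1 - q) / q) (idleLaw q m) :=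
  (integrable_eval (integrable_geometric hq) k).sub (integrable_const _)

lemma integrable_meanTime (hq : q ≠ 0) (c : TimingCode M m) (hc : c.duration q ≠ ⊤) (w : Fin M) :
    Integrable (c.meanTime q w) (idleLaw q m) := by
  rw [funext (c.meanTime_eq w)]
  exact (c.integrable_time hc w).sub (integrable_finsetSum _ fun k _ => integrable_idle_sub hq k)

lemma integral_meanTime (hq : q ≠ 0) (c : TimingCode M m) (hc : c.duration q ≠ ⊤) (w : Fin M) :
    ∫ z, c.meanTime q w z ∂(idleLaw q m) = ∫ z, c.time w z ∂(idleLaw q m) := by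
  rw [funext (c.meanTime_eq (q := q) w), integral_sub (c.integrable_time hc w)
    (integrable_finsetSum _ fun k _ => integrable_idle_sub hq k),
    integral_finsetSum _ fun k _ => integrable_idle_sub hq k, sub_eq_self]
  refine Finset.sum_eq_zero fun k _ => ?_
  rw [integral_sub (integrable_eval (integrable_geometric hq) k) (integrable_const _),
    integral_eval (fun n => (n : ℝ)) k, integral_geometric hq]
  simp

/-- The idle times under which `w` is decoded correctly. -/
def correct (c : TimingCode M m) (w : Fin M) : Set (Fin m → ℕ) := {z | c.dec (c.output w z) = w}

/-- Once the idle times are fixed, the correctly decoded messages have distinct input sequences,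
to which Kraft's inequality applies. -/
lemma sum_indicator_exp_le_one {p : ℝ} (h : Balanced q p) (c : TimingCode M m) (z : Fin m → ℕ) :
    ∑ w, (c.correct w).indicator (fun z => Real.exp (Real.log (1 - p) * c.meanTime q w z)) z
      ≤ 1 := by
  classical
  have hw : ∀ w, Real.exp (Real.log (1 - p) * c.meanTime q w z) =
      ∏ k, inputWeight p (c.enc w k z) := fun w => by
    rw [meanTime, Finset.mul_sum, Real.exp_sum]
    refine Finset.prod_congr rfl fun k _ => ?_
    rw [← h.log_inputWeight (c.one_le_enc w k z), Real.exp_log (inputWeight_pos h.pos h.lt_one _)]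
  simp only [Set.indicator_apply, ← Finset.sum_filter, hw]
  have hinj : Set.InjOn (fun w k => c.enc w k z)
      (Finset.univ.filter fun w => z ∈ c.correct w : Finset (Fin M)) := by
    intro w hw w' hw' heq
    have h1 : c.dec (c.output w z) = w := (Finset.mem_filter.1 hw).2
    have h2 : c.dec (c.output w' z) = w' := (Finset.mem_filter.1 hw').2
    have h3 : c.output w z = c.output w' z := by
      ext k
      simp only [output, congrFun heq k]
    rw [← h1, ← h2, h3]
  rw [← Finset.sum_image (f := fun v : Fin m → ℕ => ∏ k, inputWeight p (v k)) hinj]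
  refine sum_prod_inputWeight_le_one h.pos h.lt_one _ fun v hv k => ?_
  obtain ⟨w, -, rfl⟩ := Finset.mem_image.1 hv
  exact c.one_le_enc w k z

lemma sum_real_correct (c : TimingCode M m) :
    ∑ w, (idleLaw q m).real (c.correct w) = M * (1 - c.errorProb q) := by
  have hM : (M : ℝ) ≠ 0 := Nat.cast_ne_zero.2 c.size_pos.ne'
  have : ∀ w, (idleLaw q m).real {z | c.dec (c.output w z) ≠ w} =
      1 - (idleLaw q m).real (c.correct w) := fun w => by
    rw [← probReal_compl_eq_one_sub (MeasurableSet.of_discrete)]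
    rfl
  rw [errorProb, Finset.sum_congr rfl fun w _ => this w, Finset.sum_sub_distrib]
  simp
  field_simp
  ring

/-- A converse for finite block length. Integrating Kraft's inequality over the idle times and
bounding the exponential below by its tangent at an arbitrary `t` takes the place of Fano's
inequality. -/
lemma log_size_le {p : ℝ} (h : Balanced q p) (c : TimingCode M m) (hc : c.duration q ≠ ⊤)
    {ε : ℝ} (hε : ε < 1) (he : c.errorProb q ≤ ε) :
    Real.log M ≤ -Real.log (1 - p) * (c.duration q).toReal / (1 - ε) - Real.log (1 - ε) := by
  have hM : 0 < (M : ℝ) := Nat.cast_pos.2 c.size_pos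
  have hq := h.q_ne_zero
  have hL := h.log_one_sub_neg
  set L := Real.log (1 - p)
  set D := (c.duration q).toReal with hD
  have hε' : 0 < 1 - ε := sub_pos.2 hε
  -- This `t` maximizes the tangent bound `exp (-t) * ((1 + t) * (1 - ε) + L * D)`.
  set t := -L * D / (1 - ε) with ht
  have ht0 : 0 ≤ t := div_nonneg (mul_nonneg (by linarith) ENNReal.toReal_nonneg) hε'.le
  have hI : ∀ w, Integrable ((c.correct w).indicator
      fun z => Real.exp (L * c.meanTime q w z)) (idleLaw q m) := fun w => by
    refine Integrable.indicator ?_ MeasurableSet.of_discrete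
    refine Integrable.of_bound Measurable.of_discrete.aestronglyMeasurable 1
      (Eventually.of_forall fun z => ?_)
    rw [Real.norm_eq_abs, Real.abs_exp, Real.exp_le_one_iff]
    exact mul_nonpos_of_nonpos_of_nonneg hL.le (c.meanTime_nonneg w z)
  have hub : ∑ w, ∫ z, (c.correct w).indicator (fun z => Real.exp (L * c.meanTime q w z)) z
      ∂(idleLaw q m) ≤ 1 := by
    rw [← integral_finsetSum _ fun w _ => hI w]
    simpa using integral_mono (integrable_finsetSum _ fun w _ => hI w) (integrable_const (1 : ℝ))
      (c.sum_indicator_exp_le_one h)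
  have hlb : ∀ w, Real.exp (-t) * ((1 + t) * (idleLaw q m).real (c.correct w) +
      L * ∫ z, c.time w z ∂(idleLaw q m)) ≤
      ∫ z, (c.correct w).indicator (fun z => Real.exp (L * c.meanTime q w z)) z
        ∂(idleLaw q m) := fun w => by
    have hi1 : Integrable ((c.correct w).indicator fun _ => (1 + t)) (idleLaw q m) :=
      (integrable_const _).indicator MeasurableSet.of_discrete
    have hi2 := (c.integrable_meanTime hq hc w).const_mul L
    have e : ∫ z, Real.exp (-t) * ((c.correct w).indicator (fun _ => (1 + t)) z +
        L * c.meanTime q w z) ∂(idleLaw q m) = Real.exp (-t) *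
        ((1 + t) * (idleLaw q m).real (c.correct w) + L * ∫ z, c.time w z ∂(idleLaw q m)) := by
      rw [integral_const_mul, integral_add hi1 hi2, integral_const_mul, c.integral_meanTime hq hc,
        integral_indicator_const _ MeasurableSet.of_discrete, smul_eq_mul, mul_comm (1 + t)]
    rw [← e]
    refine integral_mono ((hi1.add hi2).const_mul _) (hI w) fun z => ?_
    have hY := c.meanTime_nonneg (q := q) w z
    -- Off the event of correct decoding the bound holds since `L * c.meanTime q w z ≤ 0`.
    by_cases hz : z ∈ c.correct w
    · simp only [Set.indicator_of_mem hz]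
      have h1 := Real.add_one_le_exp (L * c.meanTime q w z + t)
      have h2 : Real.exp (L * c.meanTime q w z) =
          Real.exp (-t) * Real.exp (L * c.meanTime q w z + t) := by
        rw [← Real.exp_add]
        congr 1
        ring
      rw [h2]
      exact mul_le_mul_of_nonneg_left (by linarith) (Real.exp_pos _).le
    · simp only [Set.indicator_of_notMem hz, zero_add]
      exact mul_nonpos_of_nonneg_of_nonpos (Real.exp_pos _).le
        (mul_nonpos_of_nonpos_of_nonneg hL.le hY)
  have hsum := (Finset.sum_le_sum fun w (_ : w ∈ Finset.univ) => hlb w).trans hub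
  have hDsum : ∑ w, ∫ z, c.time w z ∂(idleLaw q m) = M * D := by
    rw [hD, c.toReal_duration (c.integrable_time hc)]
    field_simp
  rw [← Finset.mul_sum, Finset.sum_add_distrib, ← Finset.mul_sum, ← Finset.mul_sum,
    c.sum_real_correct, hDsum] at hsum
  have htε : t * (1 - ε) = -L * D := by rw [ht]; field_simp
  have hkey : Real.exp (-t) * (M * (1 - ε)) ≤ 1 := by
    refine le_trans (mul_le_mul_of_nonneg_left ?_ (Real.exp_pos _).le) hsum
    have h1 : (1 + t) * (M * (1 - ε)) ≤ (1 + t) * (M * (1 - c.errorProb q)) := by gcongr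
    linear_combination h1 - (M : ℝ) * htε
  have hlog := Real.log_le_log (by positivity) hkey
  rw [Real.log_one, Real.log_mul (Real.exp_pos _).ne' (by positivity), Real.log_exp,
    Real.log_mul hM.ne' hε'.ne'] at hlog
  linarith

end TimingCode

lemma IsAchievable.mono {q : unitInterval} {𝒞 𝒟 : ∀ M m : ℕ, Set (TimingCode M m)} {R : ℝ}
    (h : IsAchievable q 𝒞 R) (hsub : ∀ M m, 𝒞 M m ⊆ 𝒟 M m) : IsAchievable q 𝒟 R :=
  fun ε hε => (h ε hε).imp fun _ h m hm =>
    let ⟨M, c, hc, h'⟩ := h m hm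
    ⟨M, c, hsub M m hc, h'⟩

/-- The converse: achievable rates do not exceed the genie bound. -/
lemma Balanced.le_of_isAchievable {q : unitInterval} {p : ℝ} (h : Balanced q p)
    {𝒞 : ∀ M m : ℕ, Set (TimingCode M m)} {R : ℝ} (hR : IsAchievable q 𝒞 R) :
    R ≤ -Real.log (1 - p) := by
  set C := -Real.log (1 - p)
  have hbound : ∀ᶠ ε in 𝓝[>] (0 : ℝ), R ≤ C / (1 - ε) - Real.log (1 - ε) + ε := by
    filter_upwards [Ioo_mem_nhdsGT (zero_lt_one' ℝ)] with ε hε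
    obtain ⟨m₀, hm₀⟩ := hR ε hε.1
    -- A positive block length makes the duration at least `1`, so the term `-log (1 - ε)` may be
    -- divided by it.
    obtain ⟨M, c, -, he, hc, hr⟩ := hm₀ (max m₀ 1) (le_max_left _ _)
    have hD : 1 ≤ (c.duration q).toReal :=
      le_trans (by exact_mod_cast le_max_right m₀ 1) (c.le_toReal_duration hc)
    have hlog := c.log_size_le h hc hε.2 he
    have hl : Real.log (1 - ε) ≤ 0 :=
      Real.log_nonpos (by linarith [hε.2]) (by linarith [hε.1])
    have hrate : c.rate q ≤ C / (1 - ε) - Real.log (1 - ε) := by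
      rw [TimingCode.rate, div_le_iff₀ (by linarith)]
      refine hlog.trans ?_
      have e : C * (c.duration q).toReal / (1 - ε) = C / (1 - ε) * (c.duration q).toReal := by
        ring
      rw [e]
      nlinarith
    linarith
  have hlim : Tendsto (fun ε : ℝ => C / (1 - ε) - Real.log (1 - ε) + ε) (𝓝[>] 0) (𝓝 C) := by
    have hcont : ContinuousAt (fun ε : ℝ => C / (1 - ε) - Real.log (1 - ε) + ε) 0 := by
      have h1 : ContinuousAt (fun ε : ℝ => 1 - ε) 0 := by fun_prop
      exact ((continuousAt_const.div h1 (by simp)).sub (h1.log (by simp))).add continuousAt_id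
    simpa using hcont.tendsto.mono_left nhdsWithin_le_nhds
  exact ge_of_tendsto hlim hbound

/-! ### Modulo encoding -/

section Modulo

variable {N : ℕ}

lemma moduloInput_eq (u : Fin N) (z : ℕ) :
    (moduloInput N u z : ℤ) = ((u : ℤ) - z) % N + 1 := by
  have hN : (N : ℤ) ≠ 0 := by exact_mod_cast (Fin.pos u).ne'
  rw [moduloInput]
  push_cast
  rw [Int.toNat_of_nonneg (Int.emod_nonneg _ hN)]

lemma one_le_moduloInput (u : Fin N) (z : ℕ) : 1 ≤ moduloInput N u z := Nat.le_add_left _ _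

lemma moduloInput_le (u : Fin N) (z : ℕ) : moduloInput N u z ≤ N := by
  have h := moduloInput_eq u z
  have := Int.emod_lt_of_pos ((u : ℤ) - z) (by exact_mod_cast Fin.pos u : (0 : ℤ) < N)
  omega

/-- The symbol is read off the channel output modulo `N`. -/
lemma moduloInput_decode (u : Fin N) (z : ℕ) : (moduloInput N u z + z - 1) % N = u := by
  have h := moduloInput_eq u z
  have h1 := one_le_moduloInput u z
  zify [show 1 ≤ moduloInput N u z + z by omega]
  rw [h, show ((u : ℤ) - z) % N + 1 + z - 1 = ((u : ℤ) - z) % N + z by ring, Int.emod_add_emod,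
    sub_add_cancel]
  exact Int.emod_eq_of_lt (by omega) (by exact_mod_cast u.2)

lemma moduloInput_injective (z : ℕ) : Function.Injective fun u => moduloInput N u z :=
  fun u u' h => Fin.ext <| by
    rw [← moduloInput_decode u z, ← moduloInput_decode u' z, show moduloInput N u z = _ from h]

lemma image_moduloInput (N z : ℕ) :
    Finset.univ.image (fun u => moduloInput N u z) = Finset.Icc 1 N := by
  refine Finset.eq_of_subset_of_card_le (fun v hv => ?_) ?_
  · obtain ⟨u, -, rfl⟩ := Finset.mem_image.1 hv
    exact Finset.mem_Icc.2 ⟨one_le_moduloInput u z, moduloInput_le u z⟩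
  · rw [Finset.card_image_of_injective _ (moduloInput_injective z)]
    simp

lemma sum_moduloInput (N z : ℕ) : ∑ u, (moduloInput N u z : ℝ) = N * (N + 1) / 2 := by
  rw [← Finset.sum_image (f := fun v : ℕ => (v : ℝ)) (moduloInput_injective z).injOn,
    image_moduloInput]
  clear z
  induction N with
  | zero => simp
  | succ n ih =>
    rw [Finset.sum_Icc_succ_top (by omega), ih]
    push_cast
    ring

variable {q : unitInterval}

lemma integrable_moduloInput (u : Fin N) :
    Integrable (fun z => (moduloInput N u z : ℝ)) (geometricMeasure q) :=
  Integrable.of_bound Measurable.of_discrete.aestronglyMeasurable N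
    (Eventually.of_forall fun z => by simpa using moduloInput_le u z)

lemma integrable_moduloTime (hq : q ≠ 0) (u : Fin N) :
    Integrable (fun z => (moduloInput N u z : ℝ) + z) (geometricMeasure q) :=
  (integrable_moduloInput u).add (integrable_geometric hq)

/-- Given `Z`, modulo encoding permutes the inputs `1, …, N`, so a uniform symbol gives a uniform
input. -/
lemma moduloDuration_uniform (hq : q ≠ 0) (hN : N ≠ 0) :
    moduloDuration q N (fun _ => (N : ℝ)⁻¹) = (N + 1) / 2 + (1 - q) / q := by
  have hN' : (N : ℝ) ≠ 0 := Nat.cast_ne_zero.2 hN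
  have hint := (integrable_geometric hq).const_mul (N : ℝ)
  rw [moduloDuration, ← Finset.mul_sum, ← integral_finsetSum _ fun u _ =>
    integrable_moduloTime hq u]
  simp only [Finset.sum_add_distrib, sum_moduloInput, Finset.sum_const, Finset.card_univ,
    Fintype.card_fin, nsmul_eq_mul]
  rw [integral_add (integrable_const _) hint, integral_const_mul, integral_geometric hq]
  simp
  field_simp

lemma sum_negMulLog_uniform (hN : N ≠ 0) :
    ∑ _u : Fin N, Real.negMulLog (N : ℝ)⁻¹ = Real.log N := by
  have hN' : (N : ℝ) ≠ 0 := Nat.cast_ne_zero.2 hN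
  simp [Real.negMulLog]
  field_simp

lemma uniformModuloRate_eq (hq : q ≠ 0) (hN : N ≠ 0) :
    uniformModuloRate q N = Real.log N / ((N + 1) / 2 + (1 - q) / q) := by
  rw [uniformModuloRate, moduloRate, sum_negMulLog_uniform hN, moduloDuration_uniform hq hN]

/-- Gibbs' inequality against the law `inputWeight p` of the input, for fixed `z`. -/
lemma Balanced.entropy_le {p : ℝ} (h : Balanced q p) {P : Fin N → ℝ}
    (hP : P ∈ stdSimplex ℝ (Fin N)) (z : ℕ) :
    ∑ u, Real.negMulLog (P u) ≤
      ∑ u, P u * (-Real.log (1 - p) * (moduloInput N u z + (1 - q) / q)) := by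
  have h1 : ∑ u, inputWeight p (moduloInput N u z) ≤ 1 := by
    rw [← Finset.sum_image (f := inputWeight p) (moduloInput_injective z).injOn, image_moduloInput]
    exact sum_inputWeight_le_one h.pos h.lt_one _ fun v hv => (Finset.mem_Icc.1 hv).1
  have h2 := Finset.sum_le_sum fun u (_ : u ∈ Finset.univ) =>
    negMulLog_le (hP.1 u) (inputWeight_pos h.pos h.lt_one (moduloInput N u z))
  rw [Finset.sum_sub_distrib, Finset.sum_sub_distrib, hP.2] at h2
  simp only [h.log_inputWeight (one_le_moduloInput _ z)] at h2
  simp only [neg_mul, mul_neg, Finset.sum_neg_distrib]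
  linarith

lemma moduloDuration_eq (hq : q ≠ 0) (P : Fin N → ℝ) :
    moduloDuration q N P =
      ∫ z, ∑ u, P u * ((moduloInput N u z : ℝ) + (1 - q) / q) ∂(geometricMeasure q) := by
  have hi : ∀ u : Fin N, Integrable (fun z => (moduloInput N u z : ℝ) + (1 - q) / q)
      (geometricMeasure q) := fun u => (integrable_moduloInput u).add (integrable_const _)
  rw [integral_finsetSum _ fun u _ => (hi u).const_mul _, moduloDuration]
  refine Finset.sum_congr rfl fun u _ => ?_
  rw [integral_const_mul, integral_add (integrable_moduloInput u) (integrable_geometric hq),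
    integral_add (integrable_moduloInput u) (integrable_const _), integral_geometric hq]
  simp

lemma moduloDuration_nonneg {P : Fin N → ℝ} (hP : P ∈ stdSimplex ℝ (Fin N)) :
    0 ≤ moduloDuration q N P :=
  Finset.sum_nonneg fun u _ => mul_nonneg (hP.1 u) (integral_nonneg fun _ => by positivity)

lemma Balanced.moduloRate_le {p : ℝ} (h : Balanced q p) {P : Fin N → ℝ}
    (hP : P ∈ stdSimplex ℝ (Fin N)) : moduloRate q N P ≤ -Real.log (1 - p) := by
  have hL := h.log_one_sub_neg
  refine div_le_of_le_mul₀ (moduloDuration_nonneg hP) (by linarith) ?_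
  rw [moduloDuration_eq h.q_ne_zero P, ← integral_const_mul]
  have hi : Integrable (fun z => ∑ u, P u * ((moduloInput N u z : ℝ) + (1 - q) / q))
      (geometricMeasure q) :=
    integrable_finsetSum _ fun u _ =>
      ((integrable_moduloInput u).add (integrable_const _)).const_mul _
  have hle := integral_mono (integrable_const _) (hi.const_mul (-Real.log (1 - p))) fun z => by
    refine (h.entropy_le hP z).trans_eq ?_
    rw [Finset.mul_sum]
    exact Finset.sum_congr rfl fun u _ => by ring
  simpa using hle

lemma uniform_mem_stdSimplex (hN : N ≠ 0) : (fun _ => (N : ℝ)⁻¹) ∈ stdSimplex ℝ (Fin N) := by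
  refine ⟨fun _ => by positivity, ?_⟩
  simp [hN]

lemma Balanced.bestModuloRate_le {p : ℝ} (h : Balanced q p) :
    bestModuloRate q ≤ -Real.log (1 - p) := by
  refine csSup_le ⟨_, 1, _, uniform_mem_stdSimplex one_ne_zero, rfl⟩ ?_
  rintro _ ⟨N, P, hP, rfl⟩
  exact h.moduloRate_le hP

lemma Balanced.uniformModuloRate_le_best {p : ℝ} (h : Balanced q p) (hN : N ≠ 0) :
    uniformModuloRate q N ≤ bestModuloRate q := by
  refine le_csSup ⟨-Real.log (1 - p), ?_⟩ ⟨N, _, uniform_mem_stdSimplex hN, rfl⟩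
  rintro _ ⟨N, P, hP, rfl⟩
  exact h.moduloRate_le hP

/-! ### Achievability -/

/-- The code that sends every word of length `m` over `{0, …, N - 1}` by modulo encoding. -/
noncomputable def fullModuloCode (N m : ℕ) (hN : 0 < N) : TimingCode (N ^ m) m where
  enc w k z := moduloInput N (finFunctionFinEquiv.symm w k) (z k)
  dec t := finFunctionFinEquiv fun k => ⟨(t k - 1) % N, Nat.mod_lt _ hN⟩
  one_le_enc _ _ _ := one_le_moduloInput _ _
  causal _ k _ _ h := by rw [h k le_rfl]

variable {m : ℕ}

lemma fullModuloCode_mem (hN : 0 < N) : fullModuloCode N m hN ∈ moduloCodes N (N ^ m) m :=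
  ⟨fun w => finFunctionFinEquiv.symm w, fun _ _ _ => rfl⟩

lemma fullModuloCode_errorProb (hN : 0 < N) : (fullModuloCode N m hN).errorProb q = 0 := by
  have h : ∀ w z, (fullModuloCode N m hN).dec ((fullModuloCode N m hN).output w z) = w := by
    intro w z
    refine (Equiv.eq_symm_apply _).1 (funext fun k => Fin.ext ?_)
    exact moduloInput_decode _ _
  simp [TimingCode.errorProb, h]

lemma integrable_symbolTime (hq : q ≠ 0) (u : Fin N) (k : Fin m) :
    Integrable (fun z : Fin m → ℕ => (moduloInput N u (z k) : ℝ) + z k)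
      (TimingCode.idleLaw q m) :=
  TimingCode.integrable_eval (integrable_moduloTime hq u) k

lemma fullModuloCode_time (hN : 0 < N) (w : Fin (N ^ m)) (z : Fin m → ℕ) :
    (fullModuloCode N m hN).time w z =
      ∑ k, ((moduloInput N (finFunctionFinEquiv.symm w k) (z k) : ℝ) + z k) := by
  simp [TimingCode.time, TimingCode.output, fullModuloCode]

lemma integrable_fullModuloCode_time (hq : q ≠ 0) (hN : 0 < N) (w : Fin (N ^ m)) :
    Integrable ((fullModuloCode N m hN).time w) (TimingCode.idleLaw q m) := by
  rw [funext (fullModuloCode_time hN w)]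
  exact integrable_finsetSum _ fun k _ => integrable_symbolTime hq _ k

lemma fullModuloCode_duration (hq : q ≠ 0) (hN : 0 < N) :
    ((fullModuloCode N m hN).duration q).toReal =
      m * moduloDuration q N fun _ => (N : ℝ)⁻¹ := by
  have hN' : (N : ℝ) ≠ 0 := Nat.cast_ne_zero.2 hN.ne'
  rw [TimingCode.toReal_duration _ (integrable_fullModuloCode_time hq hN)]
  set G : Fin N → ℝ := fun u => ∫ z, ((moduloInput N u z : ℝ) + z) ∂(geometricMeasure q)
  have h1 : ∀ w, ∫ z, (fullModuloCode N m hN).time w z ∂(TimingCode.idleLaw q m) =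
      ∑ k, G (finFunctionFinEquiv.symm w k) := fun w => by
    rw [funext (fullModuloCode_time hN w),
      integral_finsetSum _ fun k _ => integrable_symbolTime hq _ k]
    exact Finset.sum_congr rfl fun k _ => TimingCode.integral_eval
      (fun n => (moduloInput N (finFunctionFinEquiv.symm w k) n : ℝ) + n) k
  have h2 : ∀ k : Fin m, ∑ a : Fin m → Fin N, G (a k) = (N : ℝ) ^ (m - 1) * ∑ u, G u := fun k => by
    have := Fintype.sum_piFinset_apply G (Finset.univ : Finset (Fin N)) k
    rw [Fintype.piFinset_univ] at this
    rw [this]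
    simp
  rw [Finset.sum_congr rfl fun w _ => h1 w,
    Equiv.sum_comp finFunctionFinEquiv.symm fun a : Fin m → Fin N => ∑ k, G (a k),
    Finset.sum_comm, Finset.sum_congr rfl fun k _ => h2 k, moduloDuration,
    show ∑ u, (N : ℝ)⁻¹ * G u = (N : ℝ)⁻¹ * ∑ u, G u from (Finset.mul_sum _ _ _).symm]
  rcases m with _ | m
  · simp
  · simp
    field_simp
    ring

lemma fullModuloCode_rate (hq : q ≠ 0) (hN : 0 < N) (hm : m ≠ 0) :
    (fullModuloCode N m hN).rate q = uniformModuloRate q N := by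
  have hm' : (m : ℝ) ≠ 0 := Nat.cast_ne_zero.2 hm
  rw [TimingCode.rate, fullModuloCode_duration hq hN, uniformModuloRate, moduloRate,
    sum_negMulLog_uniform hN.ne']
  push_cast
  rw [Real.log_pow, mul_div_mul_left _ _ hm']

/-- Modulo encoding is free of errors, so all words can be used as codewords. -/
lemma isAchievable_uniformModuloRate (hq : q ≠ 0) (hN : 0 < N) :
    IsAchievable q (moduloCodes N) (uniformModuloRate q N) := fun ε hε =>
  ⟨1, fun m hm => ⟨N ^ m, fullModuloCode N m hN, fullModuloCode_mem hN,
    (fullModuloCode_errorProb hN).trans_le hε.le,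
    by
      rw [TimingCode.duration_eq _ (integrable_fullModuloCode_time hq hN)]
      exact ENNReal.ofReal_ne_top,
    by
      rw [fullModuloCode_rate hq hN (by omega)]
      linarith⟩⟩

lemma Balanced.uniformModuloRate_le_capacity {p : ℝ} (h : Balanced q p) (hN : 0 < N) :
    uniformModuloRate q N ≤ capacity q :=
  le_csSup ⟨_, fun _ hR => h.le_of_isAchievable hR⟩
    ((isAchievable_uniformModuloRate h.q_ne_zero hN).mono fun _ _ => Set.subset_univ _)

lemma Balanced.capacity_le {p : ℝ} (h : Balanced q p) : capacity q ≤ -Real.log (1 - p) :=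
  csSup_le ⟨_, (isAchievable_uniformModuloRate h.q_ne_zero one_pos).mono
    fun _ _ => Set.subset_univ _⟩ fun _ hR => h.le_of_isAchievable hR

end Modulo

/-! ### Asymptotic optimality -/

section Asymptotics

variable {q : unitInterval} {p : ℝ}

lemma Balanced.two_le_ceil (h : Balanced q p) : 2 ≤ ⌈1 / p⌉₊ := by
  rw [Nat.succ_le_iff, Nat.lt_ceil, Nat.cast_one, lt_div_iff₀ h.pos]
  linarith [h.lt_one]

lemma Balanced.uniformModuloRate_pos (h : Balanced q p) : 0 < uniformModuloRate q ⌈1 / p⌉₊ := by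
  have hN := h.two_le_ceil
  rw [uniformModuloRate_eq h.q_ne_zero (by omega)]
  have h1 : 0 < Real.log ⌈1 / p⌉₊ := Real.log_pos (by exact_mod_cast hN)
  have h2 : 0 ≤ (1 - (q : ℝ)) / q := div_nonneg (sub_nonneg.2 q.2.2) q.2.1
  positivity

/-- With `N = ⌈1 / p⌉` the entropy `log N` is at least `-log p`, the genie bound divided by `q`, and
the mean duration exceeds `1 / q` by at most `1 / (2 p)`, which is `o(1 / q)`. -/
lemma Balanced.genieBound_div_le (h : Balanced q p) (hq : (q : ℝ) < 1) :
    genieBound q / uniformModuloRate q ⌈1 / p⌉₊ ≤ 1 + 2 / -Real.log q := by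
  have hN := h.two_le_ceil
  have hq0 := h.q_pos
  set N := ⌈1 / p⌉₊
  have hlp : 0 < -Real.log p := neg_pos.2 (Real.log_neg h.pos h.lt_one)
  have hlog : -Real.log p ≤ Real.log N := by
    rw [← Real.log_inv, ← one_div]
    exact Real.log_le_log (one_div_pos.2 h.pos) (Nat.le_ceil _)
  have hNle : (N : ℝ) ≤ 1 / p + 1 := (Nat.ceil_lt_add_one (one_div_pos.2 h.pos).le).le
  have hdiv := h.div_le hq
  rw [h.genieBound_eq, uniformModuloRate_eq h.q_ne_zero (by omega), ← h.log_eq, div_div_eq_mul_div,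
    div_le_iff₀ (hlp.trans_le hlog)]
  have e1 : (q : ℝ) * ((N + 1) / 2 + (1 - q) / q) = 1 + q * (N - 1) / 2 := by
    field_simp
    ring
  have e2 : (q : ℝ) * (N - 1) ≤ q / p := by
    have := mul_le_mul_of_nonneg_left (sub_le_iff_le_add.2 hNle) hq0.le
    rwa [mul_one_div] at this
  have e3 : (4 : ℝ) / -Real.log q = 2 * (2 / -Real.log q) := by ring
  have hfac : 1 + (q : ℝ) * (N - 1) / 2 ≤ 1 + 2 / -Real.log q := by linarith
  have hpos : 0 ≤ 1 + (q : ℝ) * (N - 1) / 2 := by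
    have : (2 : ℝ) ≤ N := by exact_mod_cast hN
    have := mul_nonneg hq0.le (by linarith : (0 : ℝ) ≤ N - 1)
    linarith
  calc -((q : ℝ) * Real.log p) * ((N + 1) / 2 + (1 - q) / q)
      = (1 + q * (N - 1) / 2) * -Real.log p := by rw [← e1]; ring
    _ ≤ (1 + 2 / -Real.log q) * Real.log N :=
      mul_le_mul hfac hlog hlp.le (hpos.trans hfac)

end Asymptotics

end BEHC

theorem theorem3 :
    (∀ q : unitInterval, q ≠ 0 →
      ∃ p ∈ Set.Icc (0 : ℝ) 1, IsMaxOn (BEHC.genieObjective q) (Set.Icc 0 1) p) ∧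
    ∀ pstar : unitInterval → ℝ,
      (∀ q : unitInterval, q ≠ 0 → pstar q ∈ Set.Icc (0 : ℝ) 1 ∧
        IsMaxOn (BEHC.genieObjective q) (Set.Icc 0 1) (pstar q)) →
      (∀ q : unitInterval, q ≠ 0 →
        BEHC.IsAchievable q (BEHC.moduloCodes ⌈1 / pstar q⌉₊)
          (BEHC.uniformModuloRate q ⌈1 / pstar q⌉₊)) ∧
      Tendsto (fun q : unitInterval =>
        BEHC.genieBound q / BEHC.uniformModuloRate q ⌈1 / pstar q⌉₊) (𝓝[≠] 0) (𝓝 1) ∧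
      Tendsto (fun q : unitInterval =>
        BEHC.genieBound q / BEHC.bestModuloRate q) (𝓝[≠] 0) (𝓝 1) ∧
      Tendsto (fun q : unitInterval =>
        BEHC.capacity q / BEHC.uniformModuloRate q ⌈1 / pstar q⌉₊) (𝓝[≠] 0) (𝓝 1) ∧
      Tendsto (fun q : unitInterval =>
        BEHC.capacity q / BEHC.bestModuloRate q) (𝓝[≠] 0) (𝓝 1) := by
  refine ⟨fun q hq => ?_, fun pstar hpstar => ?_⟩
  · obtain ⟨p, h⟩ := BEHC.exists_balanced hq
    exact ⟨p, ⟨h.pos.le, h.lt_one.le⟩, h.isMaxOn⟩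
  have hbal : ∀ q : unitInterval, q ≠ 0 → BEHC.Balanced q (pstar q) := fun q hq => by
    obtain ⟨p, h⟩ := BEHC.exists_balanced hq
    rwa [h.eq_of_isMaxOn (hpstar q hq).1 (hpstar q hq).2]
  -- The uniform rate is positive, and the capacity and the best modulo rate lie between it and
  -- the genie bound.
  have hR : ∀ q : unitInterval, q ≠ 0 → 0 < BEHC.uniformModuloRate q ⌈1 / pstar q⌉₊ :=
    fun q hq => (hbal q hq).uniformModuloRate_pos
  have hRB : ∀ q : unitInterval, q ≠ 0 →
      BEHC.uniformModuloRate q ⌈1 / pstar q⌉₊ ≤ BEHC.bestModuloRate q := fun q hq =>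
    (hbal q hq).uniformModuloRate_le_best (by have := (hbal q hq).two_le_ceil; omega)
  have hRC : ∀ q : unitInterval, q ≠ 0 →
      BEHC.uniformModuloRate q ⌈1 / pstar q⌉₊ ≤ BEHC.capacity q := fun q hq =>
    (hbal q hq).uniformModuloRate_le_capacity (by have := (hbal q hq).two_le_ceil; omega)
  have hBG : ∀ q : unitInterval, q ≠ 0 → BEHC.bestModuloRate q ≤ BEHC.genieBound q := fun q hq =>
    (hbal q hq).genieBound_eq ▸ (hbal q hq).bestModuloRate_le
  have hCG : ∀ q : unitInterval, q ≠ 0 → BEHC.capacity q ≤ BEHC.genieBound q := fun q hq =>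
    (hbal q hq).genieBound_eq ▸ (hbal q hq).capacity_le
  have hne : ∀ᶠ q : unitInterval in 𝓝[≠] 0, q ≠ 0 := eventually_mem_nhdsWithin
  have hcoe : Tendsto (fun q : unitInterval => (q : ℝ)) (𝓝[≠] 0) (𝓝[>] 0) := by
    refine tendsto_nhdsWithin_iff.2 ⟨?_, hne.mono fun q hq => BEHC.coe_pos hq⟩
    exact (continuous_subtype_val.tendsto' (0 : unitInterval) 0 rfl).mono_left nhdsWithin_le_nhds
  have hlim : Tendsto (fun q : unitInterval => 1 + 2 / -Real.log q) (𝓝[≠] 0) (𝓝 1) := by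
    have h1 := tendsto_neg_atBot_atTop.comp (Real.tendsto_log_nhdsGT_zero.comp hcoe)
    simpa using (h1.const_div_atTop 2).const_add 1
  have hmain : Tendsto (fun q : unitInterval =>
      BEHC.genieBound q / BEHC.uniformModuloRate q ⌈1 / pstar q⌉₊) (𝓝[≠] 0) (𝓝 1) := by
    refine tendsto_of_tendsto_of_tendsto_of_le_of_le' tendsto_const_nhds hlim ?_ ?_
    · filter_upwards [hne] with q hq
      exact (one_le_div (hR q hq)).2 ((hRB q hq).trans (hBG q hq))
    · filter_upwards [hne, hcoe (Ioo_mem_nhdsGT one_pos)] with q hq hq1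
      exact (hbal q hq).genieBound_div_le hq1.2
  refine ⟨fun q hq => BEHC.isAchievable_uniformModuloRate hq
    (by have := (hbal q hq).two_le_ceil; omega), hmain, ?_, ?_, ?_⟩
  · refine tendsto_of_tendsto_of_tendsto_of_le_of_le' tendsto_const_nhds hmain ?_ ?_ <;>
      filter_upwards [hne] with q hq
    · exact (one_le_div ((hR q hq).trans_le (hRB q hq))).2 (hBG q hq)
    · exact div_le_div_of_nonneg_left ((hR q hq).le.trans ((hRB q hq).trans (hBG q hq)))
        (hR q hq) (hRB q hq)
  · refine tendsto_of_tendsto_of_tendsto_of_le_of_le' tendsto_const_nhds hmain ?_ ?_ <;>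
      filter_upwards [hne] with q hq
    · exact (one_le_div (hR q hq)).2 (hRC q hq)
    · exact div_le_div_of_nonneg_right (hCG q hq) (hR q hq).le
  · have hinv := hmain.inv₀ one_ne_zero
    rw [inv_one] at hinv
    refine tendsto_of_tendsto_of_tendsto_of_le_of_le' hinv hmain ?_ ?_ <;>
      filter_upwards [hne] with q hq
    · rw [inv_div]
      exact div_le_div₀ ((hR q hq).le.trans (hRC q hq)) (hRC q hq)
        ((hR q hq).trans_le (hRB q hq)) (hBG q hq)
    · exact div_le_div₀ ((hR q hq).le.trans ((hRB q hq).trans (hBG q hq))) (hCG q hq)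
        (hR q hq) (hRB q hq)
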